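/- **Setting.** Let $G=(V,E)$ be a finite simple undirected graph whose nodes carry distinct, totally ordered identifiers, let $\Delta$ be its maximum degree and $N(u)$ the set of neighbours of $u$. Let $\mathcal M$ be a fixed maximal (with respect to inclusion) matching of $G$. A node is *matched* if it is incident to an edge of $\mathcal M$, and *single* otherwise; for a matched node $u$, $m_u$ is the node with $(u,m_u)\in\mathcal M$. For $A\subseteq V$, $matched(A)$ and $single(A)$ are the sets of matched and of single nodes of $A$. Let $\mu$ be the number of matched nodes and $\sigma$ the number of single nodes. Each node $u$ has pointers $p_u,\alpha_u,\beta_u\in V\cup\{null\}$ and booleans $s_u,end_u$ (single nodes use only $p$ and $end$). A *configuration* is an arbitrary assignment of values to all these variables. Identifiers are compared with $null$ larger than every node; $Lowest(A)$ is the node of lowest identifier in $A\setminus\{null\}$, and $null$ if there is none; $Unique(A)$ is the number of distinct nodes ($null$ not counted) in the multiset $A$. Define the functions: * $BestRematch(u)=(a,b)$, where $a=Lowest(K)$, $b=Lowest(K\setminus\{a\})$ and $K=\{x\in single(N(u)) : p_x=u\vee end_x=False\}$. * For a matched node $u$ with $v=m_u$: $AskFirst(u)=\alpha_u$ if $\alpha_u\ne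 null$, $\alpha_v\neq null$, $Unique(\{\alpha_u,\beta_u,\alpha_v,\beta_v\})\ge 2$ and [$\alpha_u<\alpha_v$, or ($\alpha_u=\alpha_v$ and $\beta_u=null$), or ($\alpha_u=\alpha_v$ and $\beta_v\ne null$ and $u<v$)]; otherwise $AskFirst(u)=null$. * $AskSecond(u)=Lowest(\{\alpha_u,\beta_u\}\setminus\{\alpha_{m_u}\})$ if $AskFirst(m_u)\ne null$; otherwise $AskSecond(u)=null$. The algorithm MaxMatch consists of the following rules (if guard then command), listed for each kind of node from highest to lowest priority. Conditions on $p_{p_u}$ or $end_{p_u}$ presuppose $p_u\neq null$ (and $p_{p_u}=u$ is false if $p_u=null$). All the right-hand sides are evaluated in the configuration in which the rule is executed. Rules for a single node $u$: 1. *ResetEnd*: if $p_u=null$ and $end_u=True$, then $end_u:=False$. 2. *UpdateP*: if ($p_u=null$ and some $w\in matched(N(u))$ has $p_w=u$) or $p_u\notin matched(N(u))\cup\{null\}$ or ($p_u\ne null$ and $p_{p_u}\ne u$), then $p_u:=Lowest\{w\in N(u): p_w=u\}$, $end_u:=False$. 3. *UpdateEnd*: if $p_u\in matched(N(u))$, $p_{p_u}=u$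 and $end_u\ne end_{p_u}$, then $end_u:=end_{p_u}$. Rules for a matched node $u$, with $v=m_u$: 1. *Update*: if $\alpha_u>\beta_u$, or $\alpha_u\notin single(N(u))\cup\{null\}$, or $\beta_u\notin single(N(u))\cup\{null\}$, or $\alpha_u=\beta_u\ne null$, or $p_u\notin single(N(u))\cup\{null\}$, or [$(\alpha_u,\beta_u)\ne BestRematch(u)$ and ($p_u=null$ or ($p_{p_u}\ne u$ and $end_{p_u}=True$))], then $(\alpha_u,\beta_u):=BestRematch(u)$ and $(p_u,s_u,end_u):=(null,False,False)$. 2. *MatchFirst*: let $S=(p_u=AskFirst(u)\wedge p_{p_u}=u\wedge p_v\in\{AskSecond(v),null\})$ and $T=(p_u=AskFirst(u)\wedge p_{p_u}=u\wedge s_u\wedge p_v=AskSecond(v)\wedge end_v)$. If $AskFirst(u)\ne null$ and ($p_u\ne AskFirst(u)$ or $s_u\ne S$ or $end_u\ne T$), then $(end_u,s_u,p_u):=(T,S,AskFirst(u))$. 3. *MatchSecond*: let $T'=(p_u=AskSecond(u)\wedge p_{p_u}=u\wedge p_v=AskFirst(v))$. If $AskSecond(u)\ne null$, $s_v=True$ and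 ($p_u\ne AskSecond(u)$ or $end_u\ne T'$ or $s_u\ne end_u$), then $(end_u,s_u,p_u):=(T',T',AskSecond(u))$. 4. *ResetMatch*: if [$AskFirst(u)=AskSecond(u)=null$ and $(p_u,s_u,end_u)\ne(null,False,False)$] or [$AskSecond(u)\ne null$, $p_u\ne null$ and $s_v=False$], then $(p_u,s_u,end_u):=(null,False,False)$. A rule of $u$ is *activable* in a configuration if its guard holds and no guard of a rule of $u$ of higher priority holds. An *execution* is a finite or infinite sequence of transitions $C_0\mapsto C_1\mapsto\cdots$ from an arbitrary configuration $C_0$, where in each transition $C_i\mapsto C_{i+1}$ an arbitrary nonempty set of nodes each simultaneously execute one rule activable in $C_i$ (all of them reading $C_i$), and the other nodes do not change state (adversarial distributed daemon, no fairness assumption). **Theorem.** In any execution of MaxMatch, the matched nodes execute at most $$12\mu\,\bigl(\Delta(\sigma+6\mu)+\mu\bigr)$$ rules in total, that is, the number of pairs $(i,u)$ such that the matched node $u$ executes a rule in the transition $C_i\mapsto C_{i+1}$ is at most this number. -/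

import Mathlib

noncomputable section

namespace MaxMatch

open scoped Classical in
section

/-- Local variables of a process: the pointers `p`, `α`, `β` and the booleans `s`, `fin`
(the variable called *end* in the algorithm). A pointer is a node or `null`, and `null` is the top
element `⊤` of `WithTop V`; the order of `V` is the order of the identifiers. The rules
for single nodes neither read nor write the `α`, `β`, `s` of a single node. -/
@[ext] structure LocalState (V : Type*) where
  p : WithTop V
  α : WithTop V
  β : WithTop V
  s : Bool
  fin : Bool

/-- A configuration: the local states of all processes. Every value is allowed
(arbitrary initialization). -/
abbrev Config (V : Type*) := V → LocalState V

/-- The null pointer. -/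
abbrev null {V : Type*} : WithTop V := ⊤

variable {V : Type*} [Fintype V] [LinearOrder V] {G : SimpleGraph V}

/-- `u` is incident to an edge of the underlying matching. -/
def Matched (M : G.Subgraph) (u : V) : Prop := ∃ v, M.Adj u v

/-- `u` is not incident to any edge of the underlying matching. -/
def Single (M : G.Subgraph) (u : V) : Prop := ¬ Matched M u

/-- `m_u`, the node to which `u` is matched. The value `u` for a single node `u`
is a dummy: the rules only use `m_u` when `u` is matched. -/
def mate (M : G.Subgraph) (u : V) : V := if h : Matched M u then h.choose else u

/-- The node of lowest identifier satisfying `P`, and `null` if there is none. -/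
def lowest (P : V → Prop) : WithTop V := (Finset.univ.filter P).min

/-- The number of distinct nodes in a multiset of pointers (`null` is not a node). -/
def unique (A : Multiset (WithTop V)) : ℕ := (A.toFinset.erase null).card

/-- The pointer `a` is a single neighbour of `u`, that is, `a ∈ single(N(u))`. -/
def InSingleNbr (M : G.Subgraph) (u : V) (a : WithTop V) : Prop :=
  ∃ x : V, a = x ∧ G.Adj u x ∧ Single M x

/-- The pointer `a` is a matched neighbour of `u`, that is, `a ∈ matched(N(u))`. -/
def InMatchedNbr (M : G.Subgraph) (u : V) (a : WithTop V) : Prop :=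
  ∃ x : V, a = x ∧ G.Adj u x ∧ Matched M x

/-- `p_u ≠ null` and `p_{p_u} = u`. -/
def PointedBack (C : Config V) (u : V) : Prop := ∃ w : V, (C u).p = w ∧ (C w).p = u

/-- `x ∈ single(N(u))` with `p_x = u` or `end_x = False`. -/
def Cand (M : G.Subgraph) (C : Config V) (u x : V) : Prop :=
  G.Adj u x ∧ Single M x ∧ ((C x).p = u ∨ (C x).fin = false)

/-- The function *BestRematch*. -/
def bestRematch (M : G.Subgraph) (C : Config V) (u : V) : WithTop V × WithTop V :=
  let a := lowest (fun x => Cand M C u x)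
  let b := lowest (fun x => Cand M C u x ∧ (x : WithTop V) ≠ a)
  (a, b)

/-- The function *AskFirst*. -/
def askFirst (M : G.Subgraph) (C : Config V) (u : V) : WithTop V :=
  let v := mate M u
  if ((C u).α ≠ null ∧ (C v).α ≠ null ∧
        2 ≤ unique {(C u).α, (C u).β, (C v).α, (C v).β}) ∧
      ((C u).α < (C v).α ∨
        ((C u).α = (C v).α ∧ (C u).β = null) ∨
        ((C u).α = (C v).α ∧ (C v).β ≠ null ∧ u < v))
  then (C u).α else null

/-- The function *AskSecond*. -/
def askSecond (M : G.Subgraph) (C : Config V) (u : V) : WithTop V :=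
  if askFirst M C (mate M u) ≠ null then
    lowest (fun x => ((C u).α = x ∨ (C u).β = x) ∧ (C (mate M u)).α ≠ x)
  else null

/-- The value that *MatchFirst* computes for `s_u`. -/
def FirstS (M : G.Subgraph) (C : Config V) (u : V) : Prop :=
  (C u).p = askFirst M C u ∧ PointedBack C u ∧
    ((C (mate M u)).p = askSecond M C (mate M u) ∨ (C (mate M u)).p = null)

/-- The value that *MatchFirst* computes for `end_u`. -/
def FirstEnd (M : G.Subgraph) (C : Config V) (u : V) : Prop :=
  (C u).p = askFirst M C u ∧ PointedBack C u ∧ (C u).s = true ∧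
    (C (mate M u)).p = askSecond M C (mate M u) ∧ (C (mate M u)).fin = true

/-- The value that *MatchSecond* computes for `end_u` and then copies to `s_u`. -/
def SecondEnd (M : G.Subgraph) (C : Config V) (u : V) : Prop :=
  (C u).p = askSecond M C u ∧ PointedBack C u ∧
    (C (mate M u)).p = askFirst M C (mate M u)

/-- Names of the rules: the first three are for single nodes, the other four for matched nodes. -/
inductive Rule
  | resetEnd | updateP | updateEnd
  | update | matchFirst | matchSecond | resetMatch

/-- The priority of a rule among the rules of its kind of node (1 is the strongest). -/
def Rule.priority : Rule → ℕ
  | .resetEnd => 1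
  | .updateP => 2
  | .updateEnd => 3
  | .update => 1
  | .matchFirst => 2
  | .matchSecond => 3
  | .resetMatch => 4

/-- The guards of the rules, including the kind of node to which a rule applies. -/
def Guard (M : G.Subgraph) (C : Config V) (u : V) : Rule → Prop
  | .resetEnd => Single M u ∧ (C u).p = null ∧ (C u).fin = true
  | .updateP => Single M u ∧
      (((C u).p = null ∧ ∃ w, G.Adj u w ∧ Matched M w ∧ (C w).p = u) ∨
        ¬ (InMatchedNbr M u (C u).p ∨ (C u).p = null) ∨
        ((C u).p ≠ null ∧ ¬ PointedBack C u))
  | .updateEnd => Single M u ∧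
      ∃ w : V, (C u).p = w ∧ G.Adj u w ∧ Matched M w ∧ (C w).p = u ∧ (C u).fin ≠ (C w).fin
  | .update => Matched M u ∧
      ((C u).α > (C u).β ∨
        ¬ (InSingleNbr M u (C u).α ∨ (C u).α = null) ∨
        ¬ (InSingleNbr M u (C u).β ∨ (C u).β = null) ∨
        ((C u).α = (C u).β ∧ (C u).α ≠ null) ∨
        ¬ (InSingleNbr M u (C u).p ∨ (C u).p = null) ∨
        (((C u).α, (C u).β) ≠ bestRematch M C u ∧
          ((C u).p = null ∨
            ∃ w : V, (C u).p = w ∧ (C w).p ≠ u ∧ (C w).fin = true)))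
  | .matchFirst => Matched M u ∧ askFirst M C u ≠ null ∧
      ((C u).p ≠ askFirst M C u ∨
        (C u).s ≠ decide (FirstS M C u) ∨
        (C u).fin ≠ decide (FirstEnd M C u))
  | .matchSecond => Matched M u ∧ askSecond M C u ≠ null ∧ (C (mate M u)).s = true ∧
      ((C u).p ≠ askSecond M C u ∨
        (C u).fin ≠ decide (SecondEnd M C u) ∨
        (C u).s ≠ (C u).fin)
  | .resetMatch => Matched M u ∧
      (((askFirst M C u = null ∧ askSecond M C u = null) ∧
          ((C u).p, (C u).s, (C u).fin) ≠ (null, false, false)) ∨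
        (askSecond M C u ≠ null ∧ (C u).p ≠ null ∧ (C (mate M u)).s = false))

/-- The rule `r` can be executed by `u` in `C`: its guard holds, and so does the guard of no rule
of higher priority (guards of single-node and of matched-node rules exclude each other). -/
def Activable (M : G.Subgraph) (C : Config V) (u : V) (r : Rule) : Prop :=
  Guard M C u r ∧ ∀ r' : Rule, r'.priority < r.priority → ¬ Guard M C u r'

/-- The local state of `u` after it has executed the command of a rule in `C`. -/
def command (M : G.Subgraph) (C : Config V) (u : V) : Rule → LocalState V
  | .resetEnd => { C u with fin := false }
  | .updateP =>
      { C u with p := lowest (fun w => G.Adj u w ∧ (C w).p = u), fin := false }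
  | .updateEnd =>
      { C u with fin := match (C u).p with
          | (w : V) => (C w).fin
          | ⊤ => (C u).fin }
  | .update =>
      { p := null, α := (bestRematch M C u).1, β := (bestRematch M C u).2,
        s := false, fin := false }
  | .matchFirst =>
      { C u with
        p := askFirst M C u, s := decide (FirstS M C u), fin := decide (FirstEnd M C u) }
  | .matchSecond =>
      { C u with
        p := askSecond M C u, s := decide (SecondEnd M C u), fin := decide (SecondEnd M C u) }
  | .resetMatch => { C u with p := null, s := false, fin := false }

/-- A transition `C ↦ C'` in which every node `u` with `A u = some r` executes the rule `r`,
all of them simultaneously, and the other nodes do nothing. At least one rule is executed.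
This is the adversarial distributed daemon. -/
def Transition (M : G.Subgraph) (C : Config V) (A : V → Option Rule) (C' : Config V) : Prop :=
  (∃ u r, A u = some r) ∧
  (∀ u r, A u = some r → Activable M C u r ∧ C' u = command M C u r) ∧
  (∀ u, A u = none → C' u = C u)

/-- A finite or infinite execution with `length` transitions `config i ↦ config (i + 1)`,
starting from an arbitrary configuration. The values of `config` after
index `length`, and of `action` from index `length` on, are irrelevant. -/
structure Execution (M : G.Subgraph) where
  length : ℕ∞
  config : ℕ → Config V
  action : ℕ → V → Option Rule
  transition : ∀ i : ℕ, (i : ℕ∞) < length →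
    Transition M (config i) (action i) (config (i + 1))

/-- The moves of matched nodes in an execution: the pairs `(i, u)` such that the matched node `u`
executes a rule in the transition of index `i`. -/
def Execution.matchedMoves {M : G.Subgraph} (E : Execution M) : Set (ℕ × V) :=
  {q | (q.1 : ℕ∞) < E.length ∧ Matched M q.2 ∧ ∃ r, E.action q.1 q.2 = some r}

/-- `μ`, the number of matched nodes. -/
def numMatched (M : G.Subgraph) : ℕ := (Finset.univ.filter (fun u => Matched M u)).card

/-- `σ`, the number of single nodes. -/
def numSingle (M : G.Subgraph) : ℕ := (Finset.univ.filter (fun u => Single M u)).card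

end

end MaxMatch

end

/-! Three potentials are stacked, each paying for the next.

Changes of `end` at single nodes. A single node sets `end` only by copying it from a matched node
`u` while the two point to each other. Each `u` causes this at most three times (`raisesLeft_step`).
One time is due to an initial value of `end_u`. The others depend on the mate `v`. If `v` is `Good`,
then `s_v` and `end_v` are only set while `v` is pointed back, so when `u` sets `end_u` the pair
becomes `Locked`: `p_u` is then frozen and `end_u` is never withdrawn. If `v` is not `Good`, `u` may
be deceived by the arbitrary initial values of `v`, but then it is `Firm`, hence blocked until `v`
moves, and that move makes `v` `Good`. Counting the initially set values and a fall for every rise,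
single nodes change `end` at most `σ + 6μ` times.

Executions of *Update*. A change of `end` at a single node disturbs at most `Δ` matched neighbours,
and without such a disturbance an updated node does not execute *Update* again (`unrest_step`). This
gives at most `k = Δ(σ + 6μ) + μ` executions.

Other moves. While neither node of a pair executes *Update*, `α` and `β` are fixed, so the roles of
asking first and second are fixed too, and the pair acts as a small Boolean machine whose rank is at
most 18 (`orderedRank_step`, `pairRank_step_aux`). A transition with an *Update* may restore the
rank and itself contain two moves, which costs 20. In total there are at most `9μ + 20k` moves,
below the required bound since `μ ≥ 2` and `Δ ≥ 1` as soon as a matched node exists. -/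

noncomputable section

namespace MaxMatch

/-! ### The Boolean rank of a pair -/

/-- The number of moves of the node that asks second before its mate changes `s` (given by the
booleans `q`: it asks, `t`: it can be set, `s` and `e`: its variables), if its mate has set `s`. -/
def secondMoves (q t s e : Bool) : ℕ :=
  if !q then 2 else if t then (if e && s then 0 else 1) else if !e && !s then 1 else 2

/-- A bound on the moves of a pair whose pointers `α` and `β` do not change. The node that asks first
has asked if `pu`, and has been accepted if `x`; its variables are `su` and `eu`. The node that
asks second has asked if `q`, points to `null` if `n`, and has been accepted if `y`; its
variables are `sv` and `ev`. -/
def pairRank (pu x su eu q n y sv ev : Bool) : ℕ :=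
  2 * (if su then secondMoves q (y && pu) sv ev + (if x && (q || n) then 0 else 3)
    else (if n then 2 else 3)) +
  2 * ((if pu then 0 else 1) +
    (if x && (q || n) then (if su then 0 else 1) else if su then 2 else 1)) +
  (if x then 0 else 1) + (if eu == (x && su && q && ev) then 0 else 1)

theorem pairRank_le (pu x su eu q n y sv ev : Bool) : pairRank pu x su eu q n y sv ev ≤ 18 := by
  revert pu x su eu q n y sv ev
  decide +kernel

/-- The rank counts twice the remaining moves of the second node, twice the remaining changes of `p`
and `s` at the first node, the acceptance `x` still to come, and an outdated `eu`. The weight 2 pays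
for the move itself and for `eu` becoming outdated by it. It terminates because `pu`, `x` and the
condition `x && (q || n)` for setting `su` never turn false again. Here `mu` and `mv` say who moves,
and primes mark acceptances after the step; the finitely many cases are checked by evaluation. -/
theorem pairRank_step_aux : ∀ pu x su eu q n y sv ev x' y' mu mv : Bool,
    (mu → !pu || su != (x && (q || n)) || eu != (x && su && q && ev)) →
    (mv → (if su then !q || ev != (y && pu) || sv != ev else !n) = true) →
    (x → x' && pu) → (y → q) → (y && (if mv then su else q) → y') →
    pairRank (mu || pu) x' (if mu then x && (q || n) else su)
      (if mu then x && su && q && ev else eu) (if mv then su else q) (if mv then !su else n)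
      y' (if mv then su && y && pu else sv) (if mv then su && y && pu else ev) +
      mu.toNat + mv.toNat ≤ pairRank pu x su eu q n y sv ev := by
  decide +kernel

open scoped Classical in
section

set_option linter.unusedSectionVars false

variable {V : Type*} [Fintype V] [LinearOrder V] {G : SimpleGraph V} {M : G.Subgraph}
  {C C' : Config V} {A : V → Option Rule} {u v x : V}

/-! ### Mates and lowest identifiers -/

theorem mate_adj (hu : Matched M u) : M.Adj u (mate M u) := by
  rw [mate, dif_pos hu]
  exact hu.choose_spec

theorem matched_mate (hu : Matched M u) : Matched M (mate M u) := ⟨u, M.adj_symm (mate_adj hu)⟩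

theorem mate_mate (hM : M.IsMatching) (hu : Matched M u) : mate M (mate M u) = u :=
  (hM (M.edge_vert (mate_adj (matched_mate hu)))).unique (mate_adj (matched_mate hu))
    (M.adj_symm (mate_adj hu))

theorem mate_ne (hu : Matched M u) : mate M u ≠ u := (M.adj_sub (mate_adj hu)).ne'

theorem lowest_eq_top {P : V → Prop} : lowest P = ⊤ ↔ ∀ x, ¬ P x := by
  simp [lowest, Finset.min_eq_top, Finset.filter_eq_empty_iff]

theorem of_lowest_eq_coe {P : V → Prop} (h : lowest P = x) : P x := by
  simpa using Finset.mem_of_min h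

theorem lowest_le {P : V → Prop} (h : P x) : lowest P ≤ x :=
  Finset.min_le (by simpa using h)

/-! ### Local effect of one transition -/

/-- The pointer `a` is `null` or a single neighbour of `u`. -/
def Valid (M : G.Subgraph) (u : V) (a : WithTop V) : Prop := InSingleNbr M u a ∨ a = null

/-- The part of the guard of *Update* that only concerns the pointers of `u` fails. -/
def Settled (M : G.Subgraph) (C : Config V) (u : V) : Prop :=
  (C u).α ≤ (C u).β ∧ Valid M u (C u).α ∧ Valid M u (C u).β ∧
    ((C u).α = (C u).β → (C u).α = null) ∧ Valid M u (C u).p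

theorem guard_update_iff :
    Guard M C u .update ↔ Matched M u ∧ (¬ Settled M C u ∨
      (((C u).α, (C u).β) ≠ bestRematch M C u ∧
          ((C u).p = null ∨
            ∃ w : V, (C u).p = w ∧ (C w).p ≠ u ∧ (C w).fin = true))) := by
  simp only [Guard, Settled, Valid, gt_iff_lt, ← not_le]
  tauto

theorem PointedBack.ne_null (h : PointedBack C u) : (C u).p ≠ null := by
  obtain ⟨w, hw, -⟩ := h
  simp [hw]

theorem not_guard_update (hs : Settled M C u) (hp : PointedBack C u) :
    ¬ Guard M C u .update := by
  rw [guard_update_iff]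
  rintro ⟨-, h | ⟨-, h | ⟨w, hw, hw', -⟩⟩⟩
  · exact h hs
  · exact hp.ne_null h
  · obtain ⟨y, hy, hy'⟩ := hp
    rw [hy] at hw
    cases hw
    exact hw' hy'

/-- What a matched node can do in a transition. -/
theorem matched_step (h : Transition M C A C') (hu : Matched M u) :
    (A u = none ∧ C' u = C u) ∨
    (A u = some .update ∧ Guard M C u .update ∧ C' u = command M C u .update) ∨
    (A u = some .matchFirst ∧ Settled M C u ∧ Guard M C u .matchFirst ∧
      C' u = command M C u .matchFirst) ∨
    (A u = some .matchSecond ∧ Settled M C u ∧ Guard M C u .matchSecond ∧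
      C' u = command M C u .matchSecond) ∨
    (A u = some .resetMatch ∧ Settled M C u ∧ Guard M C u .resetMatch ∧
      C' u = command M C u .resetMatch) := by
  obtain ⟨-, hs, hn⟩ := h
  cases hA : A u with
  | none => exact .inl ⟨rfl, hn u hA⟩
  | some r =>
    obtain ⟨⟨hg, hp⟩, hc⟩ := hs u r hA
    have key : 1 < r.priority → Settled M C u := fun hr => by
      by_contra hns
      exact hp .update hr (guard_update_iff.2 ⟨hu, .inl hns⟩)
    cases r with
    | resetEnd => exact absurd hu hg.1
    | updateP => exact absurd hu hg.1
    | updateEnd => exact absurd hu hg.1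
    | update => exact .inr (.inl ⟨rfl, hg, hc⟩)
    | matchFirst => exact .inr (.inr (.inl ⟨rfl, key (by decide), hg, hc⟩))
    | matchSecond => exact .inr (.inr (.inr (.inl ⟨rfl, key (by decide), hg, hc⟩)))
    | resetMatch => exact .inr (.inr (.inr (.inr ⟨rfl, key (by decide), hg, hc⟩)))

/-- What a single node can do in a transition. -/
theorem single_step (h : Transition M C A C') (hx : Single M x) :
    C' x = C x ∨
    (Guard M C x .resetEnd ∧ C' x = command M C x .resetEnd) ∨
    (Guard M C x .updateP ∧ C' x = command M C x .updateP) ∨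
    (Guard M C x .updateEnd ∧ C' x = command M C x .updateEnd) := by
  obtain ⟨-, hs, hn⟩ := h
  cases hA : A x with
  | none => exact .inl (hn x hA)
  | some r =>
    obtain ⟨⟨hg, hp⟩, hc⟩ := hs x r hA
    cases r with
    | resetEnd => exact .inr (.inl ⟨hg, hc⟩)
    | updateP => exact .inr (.inr (.inl ⟨hg, hc⟩))
    | updateEnd => exact .inr (.inr (.inr ⟨hg, hc⟩))
    | update => exact absurd hg.1 hx
    | matchFirst => exact absurd hg.1 hx
    | matchSecond => exact absurd hg.1 hx
    | resetMatch => exact absurd hg.1 hx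

theorem command_updateEnd {w : V} (hw : (C x).p = w) :
    command M C x .updateEnd = { C x with fin := (C w).fin } := by
  simp only [command, hw]

/-- Mutual pointing disables *ResetEnd* and *UpdateP* at `x`; only *UpdateEnd* remains, which copies
`end_u`. -/
theorem single_of_pointed (h : Transition M C A C') (hx : Single M x) (hu : Matched M u)
    (hux : G.Adj u x) (hp : (C u).p = x) (hp' : (C x).p = u) :
    (C' x).p = u ∧ ((C' x).fin = (C x).fin ∨ (C' x).fin = (C u).fin) := by
  rcases single_step h hx with hc | ⟨hg, hc⟩ | ⟨hg, hc⟩ | ⟨hg, hc⟩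
  · rw [hc]
    exact ⟨hp', .inl rfl⟩
  · simp [Guard, hp'] at hg
  · obtain ⟨-, hg | hg | hg⟩ := hg
    · simp [hp'] at hg
    · exact absurd (.inl ⟨u, hp', hux.symm, hu⟩) hg
    · exact absurd ⟨u, hp', hp⟩ hg.2
  · rw [hc, command_updateEnd hp']
    exact ⟨hp', .inr rfl⟩

theorem single_fin_rise (h : Transition M C A C') (hx : Single M x)
    (h0 : (C x).fin = false) (h1 : (C' x).fin = true) :
    ∃ w : V, (C x).p = w ∧ G.Adj x w ∧ Matched M w ∧ (C w).p = x := by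
  rcases single_step h hx with hc | ⟨hg, hc⟩ | ⟨hg, hc⟩ | ⟨hg, hc⟩
  · simp [hc, h0] at h1
  · simp [hc, command] at h1
  · simp [hc, command] at h1
  · obtain ⟨-, w, hw, ha, hm, hp, -⟩ := hg
    exact ⟨w, hw, ha, hm, hp⟩

/-- The only rule that writes `p_x` also clears `end_x`. Thus `p_x` is stable whenever `Cand`
depends on it. -/
theorem single_p_eq (h : Transition M C A C') (hx : Single M x) (h1 : (C' x).fin = true) :
    (C' x).p = (C x).p := by
  rcases single_step h hx with hc | ⟨hg, hc⟩ | ⟨hg, hc⟩ | ⟨hg, hc⟩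
  · rw [hc]
  · simp [hc, command] at h1
  · simp [hc, command] at h1
  · rw [hc]; rfl

theorem pointed_persist (h : Transition M C A C') (hu : Matched M u)
    (hv : Valid M u (C u).p) (hp : PointedBack C u) (he : (C' u).p = (C u).p) :
    PointedBack C' u := by
  obtain ⟨w, hw, hw'⟩ := hp
  rcases hv with ⟨x, hx, hux, hxs⟩ | hv
  · rw [hx] at hw
    cases hw
    exact ⟨w, by rw [he, hx], (single_of_pointed h hxs hu hux hx hw').1⟩
  · simp [hw] at hv

/-! ### Asking first, asking second and best rematch -/

theorem askFirst_eq_or (C : Config V) (u : V) :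
    askFirst M C u = null ∨ askFirst M C u = (C u).α := by
  simp only [askFirst]
  split_ifs <;> simp

theorem askFirst_ne_null_iff : askFirst M C u ≠ null ↔
    ((C u).α ≠ null ∧ (C (mate M u)).α ≠ null ∧
        2 ≤ unique {(C u).α, (C u).β, (C (mate M u)).α, (C (mate M u)).β}) ∧
      ((C u).α < (C (mate M u)).α ∨
        ((C u).α = (C (mate M u)).α ∧ (C u).β = null) ∨
        ((C u).α = (C (mate M u)).α ∧ (C (mate M u)).β ≠ null ∧ u < mate M u)) := by
  simp only [askFirst]
  split_ifs with hc
  · exact ⟨fun _ => hc, fun _ => hc.1.1⟩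
  · exact ⟨fun h => absurd rfl h, fun h => absurd h hc⟩

theorem unique_lt_two {a : WithTop V} : unique {a, null, a, null} < 2 := by
  have : (({a, null, a, null} : Multiset (WithTop V)).toFinset.erase null) ⊆ {a} := by
    intro y
    simp
    tauto
  exact (Finset.card_le_card this).trans_lt (by simp)

/-- The clauses of the definition exclude each other when `u` and its mate are exchanged, except for
equal `α` with both `β` null, where there is only one distinct candidate (`unique_lt_two`). -/
theorem askFirst_mate_eq_null (hM : M.IsMatching) (hu : Matched M u)
    (h : askFirst M C u ≠ null) : askFirst M C (mate M u) = null := by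
  by_contra h'
  rw [← ne_eq, askFirst_ne_null_iff, mate_mate hM hu] at h'
  rw [askFirst_ne_null_iff] at h
  obtain ⟨⟨-, -, hq⟩, h⟩ := h
  obtain ⟨-, h'⟩ := h'
  rcases h with h | ⟨h, hb⟩ | ⟨h, hb, hl⟩
  · rcases h' with h' | ⟨h', -⟩ | ⟨h', -⟩
    · exact lt_asymm h h'
    · exact h.ne' h'
    · exact h.ne' h'
  · rcases h' with h' | ⟨-, hb'⟩ | ⟨-, hb', -⟩
    · exact h'.ne' h
    · rw [h, hb, hb'] at hq
      exact absurd unique_lt_two (not_lt.2 hq)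
    · exact hb' hb
  · rcases h' with h' | ⟨-, hb'⟩ | ⟨-, -, hl'⟩
    · exact h'.ne' h
    · exact hb hb'
    · exact lt_asymm hl hl'

theorem askSecond_eq_or (C : Config V) (u : V) :
    askSecond M C u = null ∨ askSecond M C u = (C u).α ∨ askSecond M C u = (C u).β := by
  unfold askSecond
  split_ifs
  · cases h : lowest (fun x : V => ((C u).α = x ∨ (C u).β = x) ∧ (C (mate M u)).α ≠ x) with
    | top => exact .inl rfl
    | coe y =>
      rcases (of_lowest_eq_coe h).1 with h | h
      · exact .inr (.inl h.symm)
      · exact .inr (.inr h.symm)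
  · exact .inl rfl

theorem askSecond_eq_null_of (h : askFirst M C (mate M u) = null) :
    askSecond M C u = null := by
  unfold askSecond
  rw [if_neg (by simpa using h)]

/-- If `α_u < α_v`, the candidate `α_v` is left for the mate `v`. If they are equal, `β_v` is left:
it is a node, by the clause itself or by the count of distinct candidates, and it differs from `α_v`
because `v` is settled. -/
theorem askSecond_mate_ne_null (hM : M.IsMatching) (hu : Matched M u)
    (h : askFirst M C u ≠ null) (hs : Settled M C (mate M u)) :
    askSecond M C (mate M u) ≠ null := by
  unfold askSecond
  rw [mate_mate hM hu, if_pos h]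
  intro hl
  rw [lowest_eq_top] at hl
  rw [askFirst_ne_null_iff] at h
  obtain ⟨⟨ha, ha', hq⟩, h⟩ := h
  rcases h with h | ⟨h, hb⟩ | ⟨h, hb, -⟩
  · obtain ⟨y, hy⟩ := WithTop.ne_top_iff_exists.1 ha'
    exact hl y ⟨.inl hy.symm, by rw [hy]; exact h.ne⟩
  · have hb' : (C (mate M u)).β ≠ null := by
      intro hb'
      rw [h, hb, hb'] at hq
      exact absurd unique_lt_two (not_lt.2 hq)
    obtain ⟨y, hy⟩ := WithTop.ne_top_iff_exists.1 hb'
    refine hl y ⟨.inr hy.symm, ?_⟩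
    rw [hy, h]
    exact fun hab => ha' (hs.2.2.2.1 hab)
  · obtain ⟨y, hy⟩ := WithTop.ne_top_iff_exists.1 hb
    refine hl y ⟨.inr hy.symm, ?_⟩
    rw [hy, h]
    exact fun hab => ha' (hs.2.2.2.1 hab)

theorem askFirst_congr (hα : (C' u).α = (C u).α) (hβ : (C' u).β = (C u).β)
    (hα' : (C' (mate M u)).α = (C (mate M u)).α)
    (hβ' : (C' (mate M u)).β = (C (mate M u)).β) : askFirst M C' u = askFirst M C u := by
  simp only [askFirst, hα, hβ, hα', hβ']

theorem askSecond_congr (hM : M.IsMatching) (hu : Matched M u)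
    (hα : (C' u).α = (C u).α) (hβ : (C' u).β = (C u).β)
    (hα' : (C' (mate M u)).α = (C (mate M u)).α)
    (hβ' : (C' (mate M u)).β = (C (mate M u)).β) : askSecond M C' u = askSecond M C u := by
  have : askFirst M C' (mate M u) = askFirst M C (mate M u) :=
    askFirst_congr hα' hβ' (by rwa [mate_mate hM hu]) (by rwa [mate_mate hM hu])
  simp only [askSecond, hα, hβ, hα', this]

theorem bestRematch_valid_fst : Valid M u (bestRematch M C u).1 := by
  cases h : (bestRematch M C u).1 with
  | top => exact .inr rfl
  | coe y =>
    obtain ⟨h1, h2, -⟩ := of_lowest_eq_coe h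
    exact .inl ⟨y, rfl, h1, h2⟩

theorem bestRematch_valid_snd : Valid M u (bestRematch M C u).2 := by
  cases h : (bestRematch M C u).2 with
  | top => exact .inr rfl
  | coe y =>
    obtain ⟨⟨h1, h2, -⟩, -⟩ := of_lowest_eq_coe h
    exact .inl ⟨y, rfl, h1, h2⟩

theorem bestRematch_fst_le_snd : (bestRematch M C u).1 ≤ (bestRematch M C u).2 := by
  cases h : (bestRematch M C u).2 with
  | top => exact le_top
  | coe y => exact lowest_le (of_lowest_eq_coe h).1

theorem bestRematch_eq_null (h : (bestRematch M C u).1 = (bestRematch M C u).2) :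
    (bestRematch M C u).1 = null := by
  cases h' : (bestRematch M C u).2 with
  | top => rw [h, h']
  | coe y => exact absurd (h.trans h').symm (of_lowest_eq_coe h').2

theorem Settled.valid_askFirst (h : Settled M C u) : Valid M u (askFirst M C u) := by
  rcases askFirst_eq_or (M := M) C u with h' | h' <;> rw [h']
  · exact .inr rfl
  · exact h.2.1

theorem Settled.valid_askSecond (h : Settled M C u) : Valid M u (askSecond M C u) := by
  rcases askSecond_eq_or (M := M) C u with h' | h' | h' <;> rw [h']
  · exact .inr rfl
  · exact h.2.1
  · exact h.2.2.1

/-! ### Settled pointers persist -/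

theorem Settled.of_eq (h : Settled M C u) (hα : (C' u).α = (C u).α) (hβ : (C' u).β = (C u).β)
    (hp : Valid M u (C' u).p) : Settled M C' u := by
  unfold Settled at h ⊢
  rw [hα, hβ]
  exact ⟨h.1, h.2.1, h.2.2.1, h.2.2.2.1, hp⟩

/-- `α_u` and `β_u` only change if `u` executes *Update*. -/
theorem pointers_eq (h : Transition M C A C') (hu : Matched M u)
    (hA : A u ≠ some .update) : (C' u).α = (C u).α ∧ (C' u).β = (C u).β := by
  rcases matched_step h hu with ⟨-, hc⟩ | ⟨hA', -⟩ | ⟨-, -, -, hc⟩ | ⟨-, -, -, hc⟩ |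
    ⟨-, -, -, hc⟩
  · rw [hc]; exact ⟨rfl, rfl⟩
  · exact absurd hA' hA
  all_goals rw [hc]; exact ⟨rfl, rfl⟩

/-- *Update* writes settled values; by priority every other rule runs only in a settled state, keeps
`α` and `β`, and writes `null` or one of them to `p`. -/
theorem settled_of_move (h : Transition M C A C') (hu : Matched M u) (hA : A u ≠ none) :
    Settled M C' u := by
  rcases matched_step h hu with ⟨hA', -⟩ | ⟨-, -, hc⟩ | ⟨-, hs, -, hc⟩ | ⟨-, hs, -, hc⟩ |
    ⟨-, hs, -, hc⟩
  · exact absurd hA' hA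
  · unfold Settled
    rw [hc]
    exact ⟨bestRematch_fst_le_snd, bestRematch_valid_fst, bestRematch_valid_snd,
      bestRematch_eq_null, .inr rfl⟩
  · exact hs.of_eq (by rw [hc]; rfl) (by rw [hc]; rfl) (by rw [hc]; exact hs.valid_askFirst)
  · exact hs.of_eq (by rw [hc]; rfl) (by rw [hc]; rfl) (by rw [hc]; exact hs.valid_askSecond)
  · exact hs.of_eq (by rw [hc]; rfl) (by rw [hc]; rfl) (by rw [hc]; exact .inr rfl)

theorem Settled.step (hs : Settled M C u) (h : Transition M C A C') (hu : Matched M u) :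
    Settled M C' u := by
  by_cases hA : A u = none
  · unfold Settled
    rwa [h.2.2 u hA]
  · exact settled_of_move h hu hA

/-! ### The two roles in a pair -/

/-- `u` and `v` are matched with each other. -/
structure IsPair (M : G.Subgraph) (u v : V) : Prop where
  left : Matched M u
  right : Matched M v
  mate_left : mate M u = v
  mate_right : mate M v = u

theorem IsPair.symm (h : IsPair M u v) : IsPair M v u := ⟨h.2, h.1, h.4, h.3⟩

theorem isPair_mate (hM : M.IsMatching) (hu : Matched M u) : IsPair M u (mate M u) :=
  ⟨hu, matched_mate hu, rfl, mate_mate hM hu⟩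

theorem IsPair.askFirst_right (hP : IsPair M u v) (hM : M.IsMatching)
    (h : askFirst M C u ≠ null) : askFirst M C v = null :=
  hP.mate_left ▸ askFirst_mate_eq_null hM hP.left h

theorem IsPair.askSecond_left (hP : IsPair M u v) (hM : M.IsMatching)
    (h : askFirst M C u ≠ null) : askSecond M C u = null :=
  askSecond_eq_null_of (by rw [hP.mate_left]; exact hP.askFirst_right hM h)

theorem IsPair.askFirst_left_ne (hP : IsPair M u v) (h : askSecond M C v ≠ null) :
    askFirst M C u ≠ null := fun h' =>
  h (askSecond_eq_null_of (by rw [hP.mate_right]; exact h'))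

theorem IsPair.askSecond_right_ne (hP : IsPair M u v) (hM : M.IsMatching)
    (h : askFirst M C u ≠ null) (hs : Settled M C v) : askSecond M C v ≠ null := by
  have := askSecond_mate_ne_null hM hP.left h
  rw [hP.mate_left] at this
  exact this hs

theorem IsPair.askFirst_eq (hP : IsPair M u v) (h : Transition M C A C')
    (hu : A u ≠ some .update) (hv : A v ≠ some .update) :
    askFirst M C' u = askFirst M C u := by
  have h1 := pointers_eq h hP.left hu
  have h2 := pointers_eq h hP.right hv
  exact askFirst_congr h1.1 h1.2 (by rw [hP.mate_left, h2.1]) (by rw [hP.mate_left, h2.2])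

theorem IsPair.askSecond_eq (hP : IsPair M u v) (hM : M.IsMatching) (h : Transition M C A C')
    (hu : A u ≠ some .update) (hv : A v ≠ some .update) :
    askSecond M C' u = askSecond M C u := by
  have h1 := pointers_eq h hP.left hu
  have h2 := pointers_eq h hP.right hv
  exact askSecond_congr hM hP.left h1.1 h1.2 (by rw [hP.mate_left, h2.1])
    (by rw [hP.mate_left, h2.2])

/-- The node that asks first can only execute *Update* and *MatchFirst*. -/
theorem IsPair.first_step (hP : IsPair M u v) (hM : M.IsMatching) (h : Transition M C A C')
    (ha : askFirst M C u ≠ null) :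
    (A u = none ∧ C' u = C u) ∨ A u = some .update ∨
    (A u = some .matchFirst ∧ Settled M C u ∧ Guard M C u .matchFirst ∧
      C' u = command M C u .matchFirst) := by
  rcases matched_step h hP.left with h1 | h1 | h1 | h1 | h1
  · exact .inl h1
  · exact .inr (.inl h1.1)
  · exact .inr (.inr h1)
  · exact absurd (hP.askSecond_left hM ha) h1.2.2.1.2.1
  · obtain ⟨-, ⟨⟨hn, -⟩, -⟩ | ⟨hn, -⟩⟩ := h1.2.2.1
    · exact absurd hn ha
    · exact absurd (hP.askSecond_left hM ha) hn

/-- The node that asks second executes *MatchSecond* if its mate has set `s`, and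
*ResetMatch* otherwise, or *Update*. -/
theorem IsPair.second_step (hP : IsPair M u v) (hM : M.IsMatching) (h : Transition M C A C')
    (ha : askFirst M C u ≠ null) :
    (A v = none ∧ C' v = C v) ∨ A v = some .update ∨
    (A v = some .matchSecond ∧ Settled M C v ∧ (C u).s = true ∧ Guard M C v .matchSecond ∧
      C' v = command M C v .matchSecond) ∨
    (A v = some .resetMatch ∧ Settled M C v ∧ (C u).s = false ∧ (C v).p ≠ null ∧
      C' v = command M C v .resetMatch) := by
  rcases matched_step h hP.right with h1 | h1 | h1 | h1 | h1
  · exact .inl h1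
  · exact .inr (.inl h1.1)
  · exact absurd (hP.askFirst_right hM ha) h1.2.2.1.2.1
  · refine .inr (.inr (.inl ⟨h1.1, h1.2.1, ?_, h1.2.2⟩))
    rw [← hP.mate_right]
    exact h1.2.2.1.2.2.1
  · refine .inr (.inr (.inr ⟨h1.1, h1.2.1, ?_⟩))
    obtain ⟨-, ⟨⟨-, hn⟩, -⟩ | ⟨hn, hp, hs⟩⟩ := h1.2.2.1
    · exact absurd hn (hP.askSecond_right_ne hM ha h1.2.1)
    · rw [hP.mate_right] at hs
      exact ⟨hs, hp, h1.2.2.2⟩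

/-! ### Invariants of a pair: good, locked and firm -/

/-- The state that `u` has forever after its first move: `s_u` and `end_u` are only set
while `u` is pointed back. -/
def Good (M : G.Subgraph) (C : Config V) (u : V) : Prop :=
  Settled M C u ∧ ((C u).s = true ∨ (C u).fin = true → PointedBack C u)

/-- A rule sets `s` or `end` only if `u` is pointed back and `p_u` already has the value being
written, so the mutual pointing survives the transition. -/
theorem good_of_move (h : Transition M C A C') (hu : Matched M u) (hA : A u ≠ none) :
    Good M C' u := by
  refine ⟨settled_of_move h hu hA, ?_⟩
  rcases matched_step h hu with ⟨hA', -⟩ | ⟨-, -, hc⟩ | ⟨-, hs, -, hc⟩ | ⟨-, hs, -, hc⟩ |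
    ⟨-, hs, -, hc⟩
  · exact absurd hA' hA
  · simp [hc, command]
  · intro hsf
    have : (C u).p = askFirst M C u ∧ PointedBack C u := by
      simp only [hc, command, decide_eq_true_eq] at hsf
      rcases hsf with hsf | hsf
      · exact ⟨hsf.1, hsf.2.1⟩
      · exact ⟨hsf.1, hsf.2.1⟩
    exact pointed_persist h hu hs.2.2.2.2 this.2 (by rw [hc, this.1]; rfl)
  · intro hsf
    have : (C u).p = askSecond M C u ∧ PointedBack C u := by
      simp only [hc, command, decide_eq_true_eq, or_self] at hsf
      exact ⟨hsf.1, hsf.2.1⟩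
    exact pointed_persist h hu hs.2.2.2.2 this.2 (by rw [hc, this.1]; rfl)
  · simp [hc, command]

theorem Good.step (hg : Good M C u) (h : Transition M C A C') (hu : Matched M u) :
    Good M C' u := by
  by_cases hA : A u = none
  · have hc := h.2.2 u hA
    refine ⟨hg.1.step h hu, fun hsf => ?_⟩
    rw [hc] at hsf
    exact pointed_persist h hu hg.1.2.2.2.2 (hg.2 hsf) (by rw [hc])
  · exact good_of_move h hu hA

/-- `u` asked first, `v` asked second, both have been accepted by single nodes and `u` has
agreed. -/
structure Core (M : G.Subgraph) (C : Config V) (u v : V) : Prop where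
  settled_left : Settled M C u
  settled_right : Settled M C v
  ask : askFirst M C u ≠ null
  p_left : (C u).p = askFirst M C u
  p_right : (C v).p = askSecond M C v
  pointed_left : PointedBack C u
  pointed_right : PointedBack C v
  agreed : (C u).s = true

theorem not_update (h : Transition M C A C') (hs : Settled M C u)
    (hp : PointedBack C u) : A u ≠ some .update := fun hA =>
  not_guard_update hs hp (h.2.1 u _ hA).1.1

theorem Core.firstS (hc : Core M C u v) (hP : IsPair M u v) : FirstS M C u := by
  refine ⟨hc.p_left, hc.pointed_left, .inl ?_⟩
  rw [hP.mate_left]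
  exact hc.p_right

theorem Core.secondEnd (hc : Core M C u v) (hP : IsPair M u v) : SecondEnd M C v := by
  refine ⟨hc.p_right, hc.pointed_right, ?_⟩
  rw [hP.mate_right]
  exact hc.p_left

theorem Core.step_left (hc : Core M C u v) (hP : IsPair M u v) (hM : M.IsMatching)
    (h : Transition M C A C') : (C' u).p = (C u).p ∧ (C' u).s = true ∧
      (A u ≠ none → (C v).fin = true → (C' u).fin = true) := by
  rcases hP.first_step hM h hc.ask with ⟨hA, h1⟩ | h1 | ⟨-, -, -, h1⟩
  · rw [h1]
    exact ⟨rfl, hc.agreed, fun hA' => absurd hA hA'⟩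
  · exact absurd h1 (not_update h hc.settled_left hc.pointed_left)
  · rw [h1]
    refine ⟨hc.p_left.symm, decide_eq_true (hc.firstS hP), fun _ hv => decide_eq_true ?_⟩
    refine ⟨hc.p_left, hc.pointed_left, hc.agreed, ?_⟩
    rw [hP.mate_left]
    exact ⟨hc.p_right, hv⟩

theorem Core.step_right (hc : Core M C u v) (hP : IsPair M u v) (hM : M.IsMatching)
    (h : Transition M C A C') : (C' v).p = (C v).p ∧
      (A v ≠ none → (C' v).fin = true) := by
  rcases hP.second_step hM h hc.ask with ⟨hA, h1⟩ | h1 | ⟨-, -, -, -, h1⟩ | ⟨-, -, hs, -⟩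
  · rw [h1]
    exact ⟨rfl, fun hA' => absurd hA hA'⟩
  · exact absurd h1 (not_update h hc.settled_right hc.pointed_right)
  · rw [h1]
    exact ⟨hc.p_right.symm, fun _ => decide_eq_true (hc.secondEnd hP)⟩
  · simp [hc.agreed] at hs

/-- Being pointed back disables *Update* at both nodes, so `α` and `β` are frozen, and any move
rewrites the same `p` and leaves `s_u` set. -/
theorem Core.step (hc : Core M C u v) (hP : IsPair M u v) (hM : M.IsMatching)
    (h : Transition M C A C') : Core M C' u v := by
  have hu := not_update h hc.settled_left hc.pointed_left
  have hv := not_update h hc.settled_right hc.pointed_right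
  obtain ⟨hpu, hsu, -⟩ := hc.step_left hP hM h
  obtain ⟨hpv, -⟩ := hc.step_right hP hM h
  have hf := hP.askFirst_eq h hu hv
  have hs := hP.symm.askSecond_eq hM h hv hu
  exact ⟨hc.settled_left.step h hP.left, hc.settled_right.step h hP.right, hf ▸ hc.ask,
    by rw [hpu, hf, hc.p_left], by rw [hpv, hs, hc.p_right],
    pointed_persist h hP.left hc.settled_left.2.2.2.2 hc.pointed_left hpu,
    pointed_persist h hP.right hc.settled_right.2.2.2.2 hc.pointed_right hpv, hsu⟩

theorem Core.fin_right_step (hc : Core M C u v) (hP : IsPair M u v) (hM : M.IsMatching)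
    (h : Transition M C A C') (hv : (C v).fin = true) : (C' v).fin = true := by
  by_cases hA : A v = none
  · rw [h.2.2 v hA, hv]
  · exact (hc.step_right hP hM h).2 hA

/-- The rematch of the pair is definite. -/
def Locked (M : G.Subgraph) (C : Config V) (u v : V) : Prop :=
  (Core M C u v ∧ (C v).fin = true) ∨ (Core M C v u ∧ (C u).fin = true)

theorem Locked.step (hl : Locked M C u v) (hP : IsPair M u v) (hM : M.IsMatching)
    (h : Transition M C A C') : Locked M C' u v ∧ (C' u).p = (C u).p ∧
      (A u ≠ none → (C' u).fin = true) := by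
  rcases hl with ⟨hc, hv⟩ | ⟨hc, hu⟩
  · exact ⟨.inl ⟨hc.step hP hM h, hc.fin_right_step hP hM h hv⟩,
      (hc.step_left hP hM h).1, fun hA => (hc.step_left hP hM h).2.2 hA hv⟩
  · exact ⟨.inr ⟨hc.step hP.symm hM h, hc.fin_right_step hP.symm hM h hu⟩,
      hc.step_right hP.symm hM h⟩

/-- `u` is ready to be matched from its own point of view and waits for a move of `v`. -/
def Firm (M : G.Subgraph) (C : Config V) (u v : V) : Prop :=
  Settled M C u ∧ PointedBack C u ∧ (C u).fin = true ∧ (C u).s = true ∧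
    (((C u).p = askFirst M C u ∧ (C v).p = askSecond M C v ∧ (C v).fin = true) ∨
      ((C u).p = askSecond M C u ∧ (C v).p = askFirst M C v ∧ (C v).s = true))

/-- All variables of `u` already have the values that its rules would write, whether `u` asks first
or second. -/
theorem Firm.action_eq_none (hf : Firm M C u v) (hP : IsPair M u v) (hM : M.IsMatching)
    (h : Transition M C A C') : A u = none := by
  obtain ⟨hs, hp, he, hsu, ⟨hpu, hpv, hev⟩ | ⟨hpu, hpv, hsv⟩⟩ := hf
  · have ha : askFirst M C u ≠ null := hpu ▸ hp.ne_null
    rcases hP.first_step hM h ha with h1 | h1 | ⟨-, -, hg, -⟩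
    · exact h1.1
    · exact absurd h1 (not_update h hs hp)
    · have h1 : FirstS M C u := ⟨hpu, hp, .inl (by rw [hP.mate_left, hpv])⟩
      have h2 : FirstEnd M C u := ⟨hpu, hp, hsu, by rw [hP.mate_left]; exact ⟨hpv, hev⟩⟩
      obtain ⟨-, -, hg | hg | hg⟩ := hg
      · exact absurd hpu hg
      · exact absurd (by rw [hsu, decide_eq_true h1]) hg
      · exact absurd (by rw [he, decide_eq_true h2]) hg
  · have ha : askFirst M C v ≠ null := hP.symm.askFirst_left_ne (hpu ▸ hp.ne_null)
    rcases hP.symm.second_step hM h ha with h1 | h1 | ⟨-, -, -, hg, -⟩ | ⟨-, -, h1, -⟩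
    · exact h1.1
    · exact absurd h1 (not_update h hs hp)
    · have h2 : SecondEnd M C u := ⟨hpu, hp, by rw [hP.mate_left]; exact hpv⟩
      obtain ⟨-, -, -, hg | hg | hg⟩ := hg
      · exact absurd hpu hg
      · exact absurd (by rw [he, decide_eq_true h2]) hg
      · exact absurd (by rw [he, hsu]) hg
    · simp [hsv] at h1

theorem Firm.step (hf : Firm M C u v) (hP : IsPair M u v) (hM : M.IsMatching)
    (h : Transition M C A C') (hv : A v = none) : Firm M C' u v := by
  have hu := hf.action_eq_none hP hM h
  have hu' : A u ≠ some .update := by simp [hu]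
  have hv' : A v ≠ some .update := by simp [hv]
  have hcu := h.2.2 u hu
  have hcv := h.2.2 v hv
  unfold Firm at hf ⊢
  rw [hP.askFirst_eq h hu' hv', hP.symm.askFirst_eq h hv' hu', hP.askSecond_eq hM h hu' hv',
    hP.symm.askSecond_eq hM h hv' hu', hcu, hcv]
  exact ⟨hf.1.step h hP.left, pointed_persist h hP.left hf.1.2.2.2.2 hf.2.1 (by rw [hcu]),
    hf.2.2⟩

/-- How `end_u` can be set. -/
theorem fin_of_move (hP : IsPair M u v) (h : Transition M C A C') (hA : A u ≠ none)
    (hf : (C' u).fin = true) :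
    Settled M C u ∧ ((FirstEnd M C u ∧ askFirst M C u ≠ null ∧
        C' u = command M C u .matchFirst) ∨
      (SecondEnd M C u ∧ askSecond M C u ≠ null ∧ (C v).s = true ∧
        C' u = command M C u .matchSecond)) := by
  rcases matched_step h hP.left with ⟨hA', -⟩ | ⟨-, -, hc⟩ | ⟨-, hs, hg, hc⟩ |
    ⟨-, hs, hg, hc⟩ | ⟨-, hs, -, hc⟩
  · exact absurd hA' hA
  · simp [hc, command] at hf
  · rw [hc] at hf
    exact ⟨hs, .inl ⟨of_decide_eq_true hf, hg.2.1, hc⟩⟩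
  · rw [hc] at hf
    refine ⟨hs, .inr ⟨of_decide_eq_true hf, hg.2.1, ?_, hc⟩⟩
    rw [← hP.mate_left]
    exact hg.2.2.1
  · simp [hc, command] at hf

/-- The rule of `u` does not check that `v` is pointed back or settled. It does read `end_v` or
`s_v` as set, from which `Good` supplies the missing parts of `Core`. -/
theorem locked_of_move (hP : IsPair M u v) (hM : M.IsMatching) (h : Transition M C A C')
    (hA : A u ≠ none) (hf : (C' u).fin = true) (hg : Good M C v) : Locked M C' u v := by
  obtain ⟨hs, ⟨⟨h1, h2, h3, h4⟩, ha, -⟩ | ⟨⟨h1, h2, h3⟩, ha, hsv, -⟩⟩ := fin_of_move hP h hA hf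
  · rw [hP.mate_left] at h4
    have : Locked M C u v := .inl ⟨⟨hs, hg.1, ha, h1, h4.1, h2, hg.2 (.inr h4.2), h3⟩, h4.2⟩
    exact (this.step hP hM h).1
  · rw [hP.mate_left] at h3
    have hc : Core M C v u :=
      ⟨hg.1, hs, hP.symm.askFirst_left_ne ha, h3, h1, hg.2 (.inl hsv), h2, hsv⟩
    exact .inr ⟨hc.step hP.symm hM h, hf⟩

/-- This covers a `v` that may hold misleading initial values: nothing is assumed about it except
that it stays idle. -/
theorem firm_of_move (hP : IsPair M u v) (hM : M.IsMatching) (h : Transition M C A C')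
    (hA : A u ≠ none) (hf : (C' u).fin = true) (hv : A v = none) : Firm M C' u v := by
  obtain ⟨hs, hk⟩ := fin_of_move hP h hA hf
  have hp : PointedBack C u ∧ (C' u).p = (C u).p := by
    rcases hk with ⟨h1, -, hc⟩ | ⟨h1, -, -, hc⟩
    · exact ⟨h1.2.1, by rw [hc, h1.1]; rfl⟩
    · exact ⟨h1.2.1, by rw [hc, h1.1]; rfl⟩
  have hu' := not_update h hs hp.1
  have hv' : A v ≠ some .update := by simp [hv]
  have hcv := h.2.2 v hv
  unfold Firm
  rw [hP.askFirst_eq h hu' hv', hP.symm.askFirst_eq h hv' hu', hP.askSecond_eq hM h hu' hv',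
    hP.symm.askSecond_eq hM h hv' hu', hcv, hp.2]
  refine ⟨hs.step h hP.left, pointed_persist h hP.left hs.2.2.2.2 hp.1 hp.2, hf, ?_⟩
  rcases hk with ⟨⟨h1, h2, h3, h4⟩, -, hc⟩ | ⟨⟨h1, h2, h3⟩, -, hsv, hc⟩
  · refine ⟨?_, .inl ⟨h1, by rwa [hP.mate_left] at h4⟩⟩
    rw [hc]
    exact decide_eq_true ⟨h1, h2, .inl h4.1⟩
  · refine ⟨?_, .inr ⟨h1, by rwa [hP.mate_left] at h3, hsv⟩⟩
    rw [hc]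
    exact decide_eq_true ⟨h1, h2, h3⟩

/-! ### How often a matched node makes a single node set `end` -/

/-- The single node that `u` points to points back and has set its variable *end*. -/
def Acknowledged (M : G.Subgraph) (C : Config V) (u : V) : Prop :=
  ∃ x : V, G.Adj u x ∧ Single M x ∧ (C u).p = x ∧ (C x).p = u ∧ (C x).fin = true

/-- In the transition from `C` to `C'`, a single node sets *end* because of `u`. -/
def Raises (M : G.Subgraph) (C C' : Config V) (u : V) : Prop :=
  ∃ x : V, G.Adj u x ∧ Single M x ∧ (C u).p = x ∧ (C x).p = u ∧ (C x).fin = false ∧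
    (C' x).fin = true

/-- `1` if `end_u` is set and this has not yet been copied by a single node. -/
def pending (M : G.Subgraph) (C : Config V) (u : V) : ℕ :=
  if (C u).fin = true ∧ ¬ Acknowledged M C u then 1 else 0

/-- A bound on the number of times that `end_u` will still be set and be copied. -/
def future (M : G.Subgraph) (C : Config V) (u v : V) : ℕ :=
  if Locked M C u v then (if (C u).fin = true then 0 else 1)
  else if Good M C v ∨ Firm M C u v then 1 else 2

theorem pending_le_one : pending M C u ≤ 1 := by
  unfold pending; split_ifs <;> simp

theorem pending_eq_zero (h : (C u).fin = false) : pending M C u = 0 := by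
  simp [pending, h]

theorem future_le_two : future M C u v ≤ 2 := by
  unfold future; split_ifs <;> simp

theorem future_le_one (h : Good M C v ∨ Firm M C u v) : future M C u v ≤ 1 := by
  unfold future; split_ifs <;> simp

theorem future_eq_zero (h : Locked M C u v) (hf : (C u).fin = true) : future M C u v = 0 := by
  simp [future, h, hf]

theorem future_eq_one (h : Locked M C u v) (hf : (C u).fin = false) : future M C u v = 1 := by
  simp [future, h, hf]

theorem Raises.pending_eq_one (hr : Raises M C C' u) (h : Transition M C A C')
    (hu : Matched M u) : pending M C u = 1 := by
  obtain ⟨x, hux, hx, hp, hp', h0, h1⟩ := hr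
  have hf : (C u).fin = true := by
    rcases (single_of_pointed h hx hu hux hp hp').2 with h' | h'
    · rw [h', h0] at h1; cases h1
    · rw [← h', h1]
  refine if_pos ⟨hf, ?_⟩
  rintro ⟨y, -, -, hy, -, hy'⟩
  rw [hp] at hy
  cases hy
  rw [h0] at hy'
  cases hy'

theorem raises_le_pending (h : Transition M C A C') (hu : Matched M u) :
    (if Raises M C C' u then 1 else 0) ≤ pending M C u := by
  split_ifs with hr
  · rw [hr.pending_eq_one h hu]
  · exact Nat.zero_le _

/-- A raise turns into an acknowledgement, and an acknowledgement persists: the single node keeps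
pointing back, and the only value it can copy is the set `end_u`. -/
theorem pending_step (h : Transition M C A C') (hu : Matched M u)
    (hp : (C' u).p = (C u).p) (hf : (C u).fin = true) :
    pending M C' u + (if Raises M C C' u then 1 else 0) ≤ pending M C u := by
  by_cases hr : Raises M C C' u
  · rw [hr.pending_eq_one h hu, if_pos hr]
    obtain ⟨x, hux, hx, hpx, hp', h0, h1⟩ := hr
    have hk : Acknowledged M C' u :=
      ⟨x, hux, hx, hp ▸ hpx, (single_of_pointed h hx hu hux hpx hp').1, h1⟩
    simp [pending, hk]
  · rw [if_neg hr, add_zero]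
    by_cases hk : Acknowledged M C u
    · obtain ⟨x, hux, hx, hpx, hp', h0⟩ := hk
      obtain ⟨h1, h2⟩ := single_of_pointed h hx hu hux hpx hp'
      have hk : Acknowledged M C' u := ⟨x, hux, hx, hp ▸ hpx, h1, by
        rcases h2 with h2 | h2
        · rw [h2, h0]
        · rw [h2, hf]⟩
      simp [pending, hk]
    · rw [show pending M C u = 1 from if_pos ⟨hf, hk⟩]
      exact pending_le_one

/-- A bound on the number of times that a single node will still set *end* because of `u`. -/
def raisesLeft (M : G.Subgraph) (C : Config V) (u v : V) : ℕ := future M C u v + pending M C u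

theorem raisesLeft_le : raisesLeft M C u v ≤ 3 :=
  Nat.add_le_add future_le_two pending_le_one

/-- The old `pending` pays for a raise. A move of `u` that sets `end_u` may create a new `pending`,
unless the pair was already locked with `end_u` set; this is paid by a drop of `future`: from 2 to 1
if `v` was not good, and from 1 to 0 otherwise, when the pair is locked afterwards. -/
theorem raisesLeft_step (hP : IsPair M u v) (hM : M.IsMatching) (h : Transition M C A C') :
    raisesLeft M C' u v + (if Raises M C C' u then 1 else 0) ≤ raisesLeft M C u v := by
  have hu := hP.left
  have hr := raises_le_pending h hu
  have hle := pending_le_one (M := M) (C := C') (u := u)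
  unfold raisesLeft
  by_cases hl : Locked M C u v
  · obtain ⟨hl', hp, hA⟩ := hl.step hP hM h
    cases hf : (C u).fin with
    | true =>
      have hf' : (C' u).fin = true := by
        by_cases hA' : A u = none
        · rw [h.2.2 u hA', hf]
        · exact hA hA'
      have := pending_step h hu hp hf
      rw [future_eq_zero hl hf, future_eq_zero hl' hf']
      omega
    | false =>
      have := pending_eq_zero (M := M) hf
      rw [future_eq_one hl hf]
      cases hf' : (C' u).fin with
      | true =>
        rw [future_eq_zero hl' hf']
        omega
      | false =>
        have := pending_eq_zero (M := M) hf'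
        rw [future_eq_one hl' hf']
        omega
  · have hgood : Good M C v → future M C' u v ≤ 1 := fun hg =>
      future_le_one (.inl (hg.step h hP.right))
    have hfu : future M C u v = if Good M C v ∨ Firm M C u v then 1 else 2 := if_neg hl
    have h2 := future_le_two (M := M) (C := C') (u := u) (v := v)
    by_cases hA : A u = none
    · have hc := h.2.2 u hA
      have h3 : pending M C' u + (if Raises M C C' u then 1 else 0) ≤ pending M C u := by
        cases hf : (C u).fin with
        | true => exact pending_step h hu (by rw [hc]) hf
        | false =>
          rw [pending_eq_zero (C := C') (by rw [hc, hf])]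
          omega
      have h4 : future M C' u v ≤ future M C u v := by
        rw [hfu]
        split_ifs with hg
        · rcases hg with hg | hg
          · exact hgood hg
          · by_cases hv : A v = none
            · exact future_le_one (.inr (hg.step hP hM h hv))
            · exact future_le_one (.inl (good_of_move h hP.right hv))
        · exact h2
      omega
    · have hnf : ¬ Firm M C u v := fun hf => hA (hf.action_eq_none hP hM h)
      cases hf : (C' u).fin with
      | false =>
        have h0 := pending_eq_zero (M := M) hf
        by_cases hg : Good M C v
        · have := hgood hg
          rw [if_pos (.inl hg)] at hfu
          omega
        · rw [if_neg (by tauto)] at hfu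
          omega
      | true =>
        by_cases hg : Good M C v
        · have := future_eq_zero (locked_of_move hP hM h hA hf hg) hf
          rw [if_pos (.inl hg)] at hfu
          omega
        · rw [if_neg (by tauto)] at hfu
          have : future M C' u v ≤ 1 := by
            by_cases hv : A v = none
            · exact future_le_one (.inr (firm_of_move hP hM h hA hf hv))
            · exact future_le_one (.inl (good_of_move h hP.right hv))
          omega

/-! ### Counting the changes of `end` at single nodes -/

/-- The matched nodes. -/
def matchedNodes (M : G.Subgraph) : Finset V := Finset.univ.filter fun u => Matched M u

/-- The single nodes. -/
def singleNodes (M : G.Subgraph) : Finset V := Finset.univ.filter fun u => Single M u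

theorem mem_matchedNodes : u ∈ matchedNodes M ↔ Matched M u := by simp [matchedNodes]

theorem mem_singleNodes : u ∈ singleNodes M ↔ Single M u := by simp [singleNodes]

/-- The single nodes that change *end* between `C` and `C'`. -/
def changedEnds (M : G.Subgraph) (C C' : Config V) : Finset V :=
  (singleNodes M).filter fun x => (C' x).fin ≠ (C x).fin

/-- Each raised `x` is charged to the matched node it copies from, and that node points to `x` only.
-/
theorem card_raised_le (h : Transition M C A C') :
    ((singleNodes M).filter fun x => (C x).fin = false ∧ (C' x).fin = true).card ≤
      ((matchedNodes M).filter fun w => Raises M C C' w).card := by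
  refine Finset.card_le_card_of_forall_subsingleton (fun x w : V => (C w).p = (x : WithTop V)) ?_ ?_
  · intro x hx
    rw [Finset.mem_filter, mem_singleNodes] at hx
    obtain ⟨hx, h0, h1⟩ := hx
    obtain ⟨w, hw, ha, hm, hp⟩ := single_fin_rise h hx h0 h1
    exact ⟨w, Finset.mem_filter.2 ⟨mem_matchedNodes.2 hm, x, ha.symm, hx, hp, hw, h0, h1⟩, hp⟩
  · rintro w - x ⟨-, hx⟩ y ⟨-, hy⟩
    exact WithTop.coe_injective (hx.symm.trans hy)

/-- A bound on the number of changes of *end* that the single nodes will still make. -/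
def endPotential (M : G.Subgraph) (C : Config V) : ℕ :=
  ((singleNodes M).filter fun x => (C x).fin = true).card +
    2 * ∑ u ∈ matchedNodes M, raisesLeft M C u (mate M u)

theorem endPotential_le : endPotential M C ≤ numSingle M + 6 * numMatched M := by
  have h1 : ((singleNodes M).filter fun x => (C x).fin = true).card ≤ numSingle M :=
    Finset.card_filter_le _ _
  have h2 : ∑ u ∈ matchedNodes M, raisesLeft M C u (mate M u) ≤ numMatched M * 3 :=
    Finset.sum_le_card_nsmul _ _ 3 fun _ _ => raisesLeft_le
  unfold endPotential
  omega

theorem endPotential_step (hM : M.IsMatching) (h : Transition M C A C') :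
    (changedEnds M C C').card + endPotential M C' ≤ endPotential M C := by
  -- Changes are rises plus falls, and rises minus falls is the growth of the number of set values.
  have h1 : (changedEnds M C C').card + ((singleNodes M).filter fun x => (C' x).fin = true).card =
      2 * ((singleNodes M).filter fun x => (C x).fin = false ∧ (C' x).fin = true).card +
        ((singleNodes M).filter fun x => (C x).fin = true).card := by
    simp only [changedEnds, Finset.card_filter, Finset.mul_sum, ← Finset.sum_add_distrib]
    refine Finset.sum_congr rfl fun x _ => ?_
    cases (C x).fin <;> cases (C' x).fin <;> simp
  have h2 := card_raised_le h
  have h3 : ∑ u ∈ matchedNodes M, raisesLeft M C' u (mate M u) +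
      ((matchedNodes M).filter fun w => Raises M C C' w).card ≤
      ∑ u ∈ matchedNodes M, raisesLeft M C u (mate M u) := by
    rw [Finset.card_filter, ← Finset.sum_add_distrib]
    exact Finset.sum_le_sum fun u hu =>
      raisesLeft_step (isPair_mate hM (mem_matchedNodes.1 hu)) hM h
  unfold endPotential
  omega

/-! ### Counting the executions of *Update* -/

/-- The single neighbours of `u` that change *end* between `C` and `C'`. -/
def changedNbrs (M : G.Subgraph) (C C' : Config V) (u : V) : Finset V :=
  (changedEnds M C C').filter fun x => G.Adj u x

/-- `Cand` reads `p_x` only when `end_x` is set; if it is set after the step, `p_x` has not changed.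
-/
theorem bestRematch_congr (h : Transition M C A C') (he : changedNbrs M C C' u = ∅) :
    bestRematch M C' u = bestRematch M C u := by
  have : Cand M C' u = Cand M C u := by
    funext x
    by_cases hx : G.Adj u x ∧ Single M x
    · have hf : (C' x).fin = (C x).fin := by
        by_contra hf
        have : x ∈ changedNbrs M C C' u := Finset.mem_filter.2
          ⟨Finset.mem_filter.2 ⟨mem_singleNodes.2 hx.2, hf⟩, hx.1⟩
        simp [he] at this
      simp only [Cand, hx, true_and, hf]
      cases h0 : (C x).fin with
      | false => simp
      | true => rw [single_p_eq h hx.2 (by rw [hf, h0])]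
    · simp only [Cand, ← and_assoc, hx, false_and]
  simp only [bestRematch, this]

/-- `0` if *Update* is disabled at `u` and stays so until a single neighbour changes *end*. -/
def unrest (M : G.Subgraph) (C : Config V) (u : V) : ℕ :=
  if Settled M C u ∧ ((C u).α, (C u).β) = bestRematch M C u then 0 else 1

/-- With no changed neighbour, *Update* installs the current `bestRematch` and so ends the unrest.
Otherwise a changed neighbour pays for the new unrest, since *Update* requires unrest beforehand. -/
theorem unrest_step (h : Transition M C A C') (hu : Matched M u) :
    unrest M C' u + (if A u = some .update then 1 else 0) ≤
      unrest M C u + (changedNbrs M C C' u).card := by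
  have hle : ∀ D : Config V, unrest M D u ≤ 1 := fun D => by
    unfold unrest; split_ifs <;> simp
  by_cases he : changedNbrs M C C' u = ∅
  · have hb := bestRematch_congr h he
    by_cases hA : A u = some .update
    · obtain ⟨⟨hg, -⟩, hc⟩ := h.2.1 u _ hA
      have h1 : unrest M C u = 1 := by
        refine if_neg fun hn => ?_
        rcases (guard_update_iff.1 hg).2 with h1 | h1
        · exact h1 hn.1
        · exact h1.1 hn.2
      have h2 : unrest M C' u = 0 := by
        refine if_pos ⟨settled_of_move h hu (by simp [hA]), ?_⟩
        rw [hb, hc]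
        rfl
      rw [h1, h2, if_pos hA]
      omega
    · have h1 := pointers_eq h hu hA
      rw [if_neg hA]
      by_cases hn : Settled M C u ∧ ((C u).α, (C u).β) = bestRematch M C u
      · have h2 : unrest M C' u = 0 := by
          refine if_pos ⟨hn.1.step h hu, ?_⟩
          rw [hb, h1.1, h1.2, hn.2]
        omega
      · have h2 : unrest M C u = 1 := if_neg hn
        have := hle C'
        omega
  · have h1 : 0 < (changedNbrs M C C' u).card := Finset.card_pos.2 (Finset.nonempty_of_ne_empty he)
    have h2 : unrest M C u = 0 → A u ≠ some .update := by
      intro h0 hA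
      obtain ⟨⟨hg, -⟩, hc⟩ := h.2.1 u _ hA
      unfold unrest at h0
      split_ifs at h0 with hn
      rcases (guard_update_iff.1 hg).2 with h1 | h1
      · exact h1 hn.1
      · exact h1.1 hn.2
    have := hle C'
    split_ifs with hA
    · have : unrest M C u ≠ 0 := fun h0 => h2 h0 hA
      omega
    · omega

/-- A bound on the number of executions of *Update* that remain, if `d` bounds the degrees. -/
def updatePotential (M : G.Subgraph) (d : ℕ) (C : Config V) : ℕ :=
  ∑ u ∈ matchedNodes M, unrest M C u + d * endPotential M C

theorem updatePotential_le (d : ℕ) :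
    updatePotential M d C ≤ d * (numSingle M + 6 * numMatched M) + numMatched M := by
  have h1 : ∑ u ∈ matchedNodes M, unrest M C u ≤ numMatched M * 1 :=
    Finset.sum_le_card_nsmul _ _ 1 fun u _ => by
      unfold unrest; split_ifs <;> simp
  have h2 := Nat.mul_le_mul_left d (endPotential_le (M := M) (C := C))
  unfold updatePotential
  omega

/-- The matched nodes that execute *Update*. -/
def updating (M : G.Subgraph) (A : V → Option Rule) : Finset V :=
  (matchedNodes M).filter fun u => A u = some .update

theorem updatePotential_step {d : ℕ}
    (hd : ∀ x, (Finset.univ.filter fun u => G.Adj x u).card ≤ d)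
    (hM : M.IsMatching) (h : Transition M C A C') :
    (updating M A).card + updatePotential M d C' ≤ updatePotential M d C := by
  have h1 := Nat.mul_le_mul_left d (endPotential_step hM h)
  rw [mul_add] at h1
  have h2 : ∑ u ∈ matchedNodes M, unrest M C' u + (updating M A).card ≤
      ∑ u ∈ matchedNodes M, unrest M C u +
        ∑ u ∈ matchedNodes M, (changedNbrs M C C' u).card := by
    rw [updating, Finset.card_filter, ← Finset.sum_add_distrib, ← Finset.sum_add_distrib]
    exact Finset.sum_le_sum fun u hu => unrest_step h (mem_matchedNodes.1 hu)
  -- Double counting: each single node that changes `end` is seen by at most `d` neighbours.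
  have h3 : ∑ u ∈ matchedNodes M, (changedNbrs M C C' u).card ≤
      (changedEnds M C C').card * d := by
    simp only [changedNbrs, Finset.card_filter]
    rw [Finset.sum_comm]
    refine Finset.sum_le_card_nsmul _ _ d fun x _ => ?_
    rw [← Finset.card_filter]
    refine le_trans (Finset.card_le_card fun u hu => ?_) (hd x)
    simp only [Finset.mem_filter] at hu ⊢
    exact ⟨Finset.mem_univ u, hu.2.symm⟩
  rw [mul_comm] at h3
  unfold updatePotential
  omega

/-! ### Moves of a pair between executions of *Update* -/

/-- The rank of a pair in which `u` asks first. -/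
def orderedRank (M : G.Subgraph) (C : Config V) (u v : V) : ℕ :=
  pairRank (decide ((C u).p = askFirst M C u))
    (decide (Settled M C u ∧ (C u).p = askFirst M C u ∧ PointedBack C u))
    (C u).s (C u).fin
    (decide ((C v).p = askSecond M C v)) (decide ((C v).p = null))
    (decide (Settled M C v ∧ (C v).p = askSecond M C v ∧ PointedBack C v))
    (C v).s (C v).fin

/-- The conjunct `Settled` in the acceptance Booleans makes acceptance persistent; it costs nothing
when a node moves, since moves other than *Update* need a settled state. -/
theorem decide_firstS (hP : IsPair M u v) (hs : Settled M C u) : decide (FirstS M C u) =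
    (decide (Settled M C u ∧ (C u).p = askFirst M C u ∧ PointedBack C u) &&
      (decide ((C v).p = askSecond M C v) || decide ((C v).p = null))) := by
  rw [Bool.eq_iff_iff]
  simp only [FirstS, hP.mate_left, hs, decide_eq_true_eq, Bool.and_eq_true, Bool.or_eq_true]
  tauto

theorem decide_firstEnd (hP : IsPair M u v) (hs : Settled M C u) : decide (FirstEnd M C u) =
    (decide (Settled M C u ∧ (C u).p = askFirst M C u ∧ PointedBack C u) &&
      (C u).s && decide ((C v).p = askSecond M C v) && (C v).fin) := by
  rw [Bool.eq_iff_iff]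
  simp only [FirstEnd, hP.mate_left, hs, decide_eq_true_eq, Bool.and_eq_true]
  tauto

theorem decide_secondEnd (hP : IsPair M u v) (hs : Settled M C v) : decide (SecondEnd M C v) =
    (decide (Settled M C v ∧ (C v).p = askSecond M C v ∧ PointedBack C v) &&
      decide ((C u).p = askFirst M C u)) := by
  rw [Bool.eq_iff_iff]
  simp only [SecondEnd, hP.mate_right, hs, decide_eq_true_eq, Bool.and_eq_true]
  tauto

theorem orderedRank_step (hP : IsPair M u v) (hM : M.IsMatching) (h : Transition M C A C')
    (ha : askFirst M C u ≠ null) (hu : A u ≠ some .update) (hv : A v ≠ some .update) :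
    orderedRank M C' u v + (decide (A u ≠ none)).toNat + (decide (A v ≠ none)).toNat ≤
      orderedRank M C u v := by
  have hf := hP.askFirst_eq h hu hv
  have hs := hP.symm.askSecond_eq hM h hv hu
  have keyu : (decide ((C' u).p = askFirst M C' u) =
        (decide (A u ≠ none) || decide ((C u).p = askFirst M C u))) ∧
      ((C' u).s = if decide (A u ≠ none) = true then
        (decide (Settled M C u ∧ (C u).p = askFirst M C u ∧ PointedBack C u) &&
          (decide ((C v).p = askSecond M C v) || decide ((C v).p = null))) else (C u).s) ∧
      ((C' u).fin = if decide (A u ≠ none) = true then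
        (decide (Settled M C u ∧ (C u).p = askFirst M C u ∧ PointedBack C u) &&
          (C u).s && decide ((C v).p = askSecond M C v) && (C v).fin) else (C u).fin) ∧
      (decide (A u ≠ none) = true → (!decide ((C u).p = askFirst M C u) ||
        (C u).s != (decide (Settled M C u ∧ (C u).p = askFirst M C u ∧ PointedBack C u) &&
          (decide ((C v).p = askSecond M C v) || decide ((C v).p = null))) ||
        (C u).fin != (decide (Settled M C u ∧ (C u).p = askFirst M C u ∧ PointedBack C u) &&
          (C u).s && decide ((C v).p = askSecond M C v) && (C v).fin)) = true) := by
    rcases hP.first_step hM h ha with ⟨hA, hc⟩ | hA | ⟨hA, hsu, ⟨-, -, hg⟩, hc⟩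
    · simp [hA, hf, hc]
    · exact absurd hA hu
    · rw [← decide_firstS hP hsu, ← decide_firstEnd hP hsu, hf, hc]
      simpa [hA, command, or_assoc] using hg
  have keyv : (decide ((C' v).p = askSecond M C' v) =
        if decide (A v ≠ none) = true then (C u).s else decide ((C v).p = askSecond M C v)) ∧
      (decide ((C' v).p = null) =
        if decide (A v ≠ none) = true then !(C u).s else decide ((C v).p = null)) ∧
      ((C' v).s = if decide (A v ≠ none) = true then (C u).s &&
        decide (Settled M C v ∧ (C v).p = askSecond M C v ∧ PointedBack C v) &&
        decide ((C u).p = askFirst M C u) else (C v).s) ∧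
      ((C' v).fin = if decide (A v ≠ none) = true then (C u).s &&
        decide (Settled M C v ∧ (C v).p = askSecond M C v ∧ PointedBack C v) &&
        decide ((C u).p = askFirst M C u) else (C v).fin) ∧
      (decide (A v ≠ none) = true → (if (C u).s = true then
        (!decide ((C v).p = askSecond M C v) ||
        (C v).fin != (decide (Settled M C v ∧ (C v).p = askSecond M C v ∧ PointedBack C v) &&
          decide ((C u).p = askFirst M C u)) || (C v).s != (C v).fin) else
        !decide ((C v).p = null)) = true) := by
    rcases hP.second_step hM h ha with ⟨hA, hc⟩ | hA | ⟨hA, hsv, hsu, ⟨-, hb, -, hg⟩, hc⟩ |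
      ⟨hA, hsv, hsu, hp, hc⟩
    · simp [hA, hs, hc]
    · exact absurd hA hv
    · simp only [Bool.and_assoc]
      rw [← decide_secondEnd hP hsv, hs, hc]
      simpa [hA, command, hsu, hb, or_assoc] using hg
    · have hb := (hP.askSecond_right_ne hM ha hsv).symm
      rw [hs, hc]
      simp [hA, command, hsu, hb, hp]
  have hx : decide (Settled M C u ∧ (C u).p = askFirst M C u ∧ PointedBack C u) = true →
      (decide (Settled M C' u ∧ (C' u).p = askFirst M C' u ∧ PointedBack C' u) &&
        decide ((C u).p = askFirst M C u)) = true := by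
    simp only [decide_eq_true_eq, Bool.and_eq_true]
    rintro ⟨h1, h2, h3⟩
    have h4 : (C' u).p = askFirst M C' u := by
      have := keyu.1
      simpa [h2] using this
    exact ⟨⟨h1.step h hP.left, h4, pointed_persist h hP.left h1.2.2.2.2 h3
      (by rw [h4, hf, h2])⟩, h2⟩
  have hy : decide (Settled M C v ∧ (C v).p = askSecond M C v ∧ PointedBack C v) = true →
      decide ((C v).p = askSecond M C v) = true := by
    simp only [decide_eq_true_eq]
    exact fun h1 => h1.2.1
  have hy' : (decide (Settled M C v ∧ (C v).p = askSecond M C v ∧ PointedBack C v) &&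
      decide ((C' v).p = askSecond M C' v)) = true →
      decide (Settled M C' v ∧ (C' v).p = askSecond M C' v ∧ PointedBack C' v) = true := by
    simp only [decide_eq_true_eq, Bool.and_eq_true]
    rintro ⟨⟨h1, h2, h3⟩, h4⟩
    exact ⟨h1.step h hP.right, h4, pointed_persist h hP.right h1.2.2.2.2 h3
      (by rw [h4, hs, h2])⟩
  -- Acceptance of `v` survives only if `v` still asks after the step, which may fail because
  -- *ResetMatch* clears `p_v`.
  rw [keyv.1] at hy'
  unfold orderedRank
  rw [keyu.1, keyu.2.1, keyu.2.2.1, keyv.1, keyv.2.1, keyv.2.2.1, keyv.2.2.2.1]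
  exact pairRank_step_aux _ _ _ _ _ _ _ _ _ _ _ _ _ keyu.2.2.2 keyv.2.2.2.2 hx hy hy'

/-- `0` if `u` is in the state that *ResetMatch* produces, and `1` otherwise. -/
def resetRank (C : Config V) (u : V) : ℕ :=
  if ((C u).p, (C u).s, (C u).fin) = (null, false, false) then 0 else 1

theorem resetRank_step (hP : IsPair M u v) (h : Transition M C A C')
    (hu : A u ≠ some .update) (ha : askFirst M C u = null) (hb : askFirst M C v = null) :
    resetRank C' u + (decide (A u ≠ none)).toNat ≤ resetRank C u := by
  have hs : askSecond M C u = null := askSecond_eq_null_of (by rwa [hP.mate_left])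
  rcases matched_step h hP.left with ⟨hA, hc⟩ | ⟨hA, -⟩ | ⟨-, -, ⟨-, hn, -⟩, -⟩ |
    ⟨-, -, ⟨-, hn, -⟩, -⟩ | ⟨hA, -, ⟨-, ⟨-, hg⟩ | ⟨hn, -⟩⟩, hc⟩
  · simp [hA, resetRank, hc]
  · exact absurd hA hu
  · exact absurd ha hn
  · exact absurd hs hn
  · rw [resetRank, resetRank, if_neg hg, hc]
    simp [hA, command]
  · exact absurd hs hn

/-- A bound on the number of moves of `u` and `v` until one of them executes *Update*. -/
def pairPotential (M : G.Subgraph) (C : Config V) (u v : V) : ℕ :=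
  if askFirst M C u ≠ null then orderedRank M C u v
  else if askFirst M C v ≠ null then orderedRank M C v u
  else resetRank C u + resetRank C v

theorem pairPotential_le : pairPotential M C u v ≤ 18 := by
  unfold pairPotential resetRank
  split_ifs
  all_goals first
    | exact pairRank_le _ _ _ _ _ _ _ _ _
    | omega

theorem pairPotential_step (hP : IsPair M u v) (hM : M.IsMatching) (h : Transition M C A C') :
    pairPotential M C' u v + ((if A u ≠ none then 1 else 0) + (if A v ≠ none then 1 else 0)) ≤
      pairPotential M C u v +
        20 * ((if A u = some .update then 1 else 0) + (if A v = some .update then 1 else 0)) := by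
  have hle := pairPotential_le (M := M) (C := C') (u := u) (v := v)
  -- An *Update* pays 20: at most 18 for the new potential and 2 for the moves of this transition.
  by_cases hu : A u = some .update
  · rw [if_pos hu]
    split_ifs <;> omega
  by_cases hv : A v = some .update
  · rw [if_pos hv]
    split_ifs <;> omega
  rw [if_neg hu, if_neg hv]
  have toNat_eq : ∀ w, (decide (A w ≠ none)).toNat = if A w ≠ none then 1 else 0 := fun w => by
    by_cases hw : A w = none <;> simp [hw]
  rw [← toNat_eq, ← toNat_eq]
  unfold pairPotential
  rw [hP.askFirst_eq h hu hv, hP.symm.askFirst_eq h hv hu]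
  split_ifs with h1 h2
  · have := orderedRank_step hP hM h h1 hu hv
    omega
  · have := orderedRank_step hP.symm hM h h2 hv hu
    omega
  · rw [not_not] at h1 h2
    have := resetRank_step hP h hu h1 h2
    have := resetRank_step hP.symm h hv h2 h1
    omega

/-! ### The total potential -/

/-- The matched nodes that execute a rule. -/
def moving (M : G.Subgraph) (A : V → Option Rule) : Finset V :=
  (matchedNodes M).filter fun u => A u ≠ none

theorem sum_mate (hM : M.IsMatching) (f : V → ℕ) :
    ∑ u ∈ matchedNodes M, f (mate M u) = ∑ u ∈ matchedNodes M, f u := by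
  have hm : ∀ u ∈ matchedNodes M, mate M u ∈ matchedNodes M := fun u hu =>
    mem_matchedNodes.2 (matched_mate (mem_matchedNodes.1 hu))
  have hi : ∀ u ∈ matchedNodes M, mate M (mate M u) = u := fun u hu =>
    mate_mate hM (mem_matchedNodes.1 hu)
  exact Finset.sum_bij' (fun u _ => mate M u) (fun u _ => mate M u) hm hm hi hi fun _ _ => rfl

/-- A bound on twice the number of moves of matched nodes that remain, if `d` bounds the
degrees. -/
def movePotential (M : G.Subgraph) (d : ℕ) (C : Config V) : ℕ :=
  ∑ u ∈ matchedNodes M, pairPotential M C u (mate M u) + 40 * updatePotential M d C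

/-- Summing over matched nodes sees every pair from both ends, hence the factor 2 on moves and the
40, twice the price 20 of an *Update*. -/
theorem movePotential_step {d : ℕ}
    (hd : ∀ x, (Finset.univ.filter fun u => G.Adj x u).card ≤ d)
    (hM : M.IsMatching) (h : Transition M C A C') :
    2 * (moving M A).card + movePotential M d C' ≤ movePotential M d C := by
  have h1 := updatePotential_step hd hM h
  have h2 := Finset.sum_le_sum fun u hu =>
    pairPotential_step (isPair_mate hM (mem_matchedNodes.1 hu)) hM h
  simp only [Finset.sum_add_distrib, ← Finset.mul_sum,
    sum_mate hM fun u => if A u ≠ none then 1 else 0,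
    sum_mate hM fun u => if A u = some .update then 1 else 0, ← Finset.card_filter] at h2
  unfold movePotential
  unfold moving
  unfold updating at h1
  omega

theorem movePotential_le {d : ℕ}
    (hd : ∀ x, (Finset.univ.filter fun u => G.Adj x u).card ≤ d) (hu : Matched M u) :
    movePotential M d C ≤ 2 * (12 * numMatched M *
      (d * (numSingle M + 6 * numMatched M) + numMatched M)) := by
  have h1 : ∑ u ∈ matchedNodes M, pairPotential M C u (mate M u) ≤ numMatched M * 18 :=
    Finset.sum_le_card_nsmul _ _ 18 fun _ _ => pairPotential_le
  have h2 := updatePotential_le (M := M) (C := C) d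
  unfold movePotential
  have hm : 2 ≤ numMatched M := by
    have : ({u, mate M u} : Finset V) ⊆ matchedNodes M := by
      intro y
      simp only [Finset.mem_insert, Finset.mem_singleton, mem_matchedNodes]
      rintro (rfl | rfl)
      · exact hu
      · exact matched_mate hu
    have := Finset.card_le_card this
    rwa [Finset.card_pair (mate_ne hu).symm] at this
  have hd1 : 1 ≤ d := by
    refine le_trans (Finset.card_pos.2 ⟨mate M u, ?_⟩) (hd u)
    simpa using M.adj_sub (mate_adj hu)
  generalize numMatched M = m at *
  set k := d * (numSingle M + 6 * m) + m with hk
  -- The potential is at most `18m + 40k`. Since `18m ≤ 8k` and `m ≥ 2`, this is at most `48k ≤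
  -- 24mk`.
  have h3 : 7 * m ≤ k := by
    have := Nat.mul_le_mul_right (numSingle M + 6 * m) hd1
    omega
  have h4 : 2 * k ≤ m * k := Nat.mul_le_mul_right k hm
  have h5 : 2 * (12 * m * k) = 24 * (m * k) := by ring
  omega

/-! ### From transitions to executions -/

namespace Execution

variable (E : Execution M)

/-- The moves of matched nodes in the first `n` transitions. -/
def movesBefore (n : ℕ) : Finset (ℕ × V) :=
  (Finset.range n ×ˢ Finset.univ).filter fun q => q ∈ E.matchedMoves

theorem card_movesBefore_succ (n : ℕ) : (E.movesBefore (n + 1)).card ≤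
    (E.movesBefore n).card +
      if (n : ℕ∞) < E.length then (moving M (E.action n)).card else 0 := by
  have hsub : E.movesBefore (n + 1) ⊆ E.movesBefore n ∪
      if (n : ℕ∞) < E.length then (moving M (E.action n)).image (Prod.mk n) else ∅ := by
    rintro ⟨i, w⟩ hq
    simp only [movesBefore, Finset.mem_union, Finset.mem_filter, Finset.mem_product,
      Finset.mem_range, Finset.mem_univ, and_true] at hq ⊢
    obtain ⟨hi, hq⟩ := hq
    rcases Nat.lt_succ_iff_lt_or_eq.1 hi with hi | rfl
    · exact .inl ⟨hi, hq⟩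
    · right
      obtain ⟨hl, hw, r, hr⟩ := hq
      rw [if_pos hl]
      refine Finset.mem_image_of_mem _ (Finset.mem_filter.2 ⟨mem_matchedNodes.2 hw, ?_⟩)
      simp [hr]
  refine (Finset.card_le_card hsub).trans ((Finset.card_union_le _ _).trans ?_)
  gcongr
  split_ifs
  · exact Finset.card_image_le
  · simp

theorem two_mul_card_movesBefore_le {d : ℕ}
    (hd : ∀ x, (Finset.univ.filter fun u => G.Adj x u).card ≤ d) (hM : M.IsMatching) (n : ℕ) :
    2 * (E.movesBefore n).card ≤ movePotential M d (E.config 0) := by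
  -- Configurations beyond the length are meaningless, so the potential is replaced by 0 there.
  have key : ∀ n : ℕ, 2 * (E.movesBefore n).card +
      (if (n : ℕ∞) ≤ E.length then movePotential M d (E.config n) else 0) ≤
        movePotential M d (E.config 0) := by
    intro n
    induction n with
    | zero => simp [movesBefore]
    | succ n ih =>
      have h1 := E.card_movesBefore_succ n
      by_cases hl : (n : ℕ∞) < E.length
      · have h2 := movePotential_step hd hM (E.transition n hl)
        rw [if_pos hl] at h1
        rw [if_pos hl.le] at ih
        split_ifs <;> omega
      · have h2 : ¬ ((n + 1 : ℕ) : ℕ∞) ≤ E.length := fun h =>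
          hl (lt_of_lt_of_le (by exact_mod_cast n.lt_succ_self) h)
        rw [if_neg hl] at h1
        rw [if_neg h2]
        omega
  exact (Nat.le_add_right _ _).trans (key n)

theorem encard_matchedMoves_le {N : ℕ} (h : ∀ n, (E.movesBefore n).card ≤ N) :
    E.matchedMoves.encard ≤ N := by
  by_contra hlt
  rw [not_le] at hlt
  -- Were there more than `N` moves, some `N + 1` of them would lie in a finite prefix; this also
  -- handles infinite executions.
  obtain ⟨t, ht, hcard⟩ := Set.exists_subset_encard_eq (Order.add_one_le_of_lt hlt)
  have hfin : t.Finite := Set.finite_of_encard_eq_coe (k := N + 1) (by rw [hcard]; norm_cast)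
  obtain ⟨n, hn⟩ := (hfin.image Prod.fst).bddAbove
  have hsub : hfin.toFinset ⊆ E.movesBefore (n + 1) := by
    intro q hq
    rw [Set.Finite.mem_toFinset] at hq
    refine Finset.mem_filter.2 ⟨Finset.mem_product.2 ⟨?_, Finset.mem_univ _⟩, ht hq⟩
    exact Finset.mem_range_succ_iff.2 (hn (Set.mem_image_of_mem _ hq))
  have h1 := (Finset.card_le_card hsub).trans (h _)
  rw [hfin.encard_eq_coe_toFinset_card] at hcard
  have h2 : hfin.toFinset.card = N + 1 := by exact_mod_cast hcard
  omega

end Execution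

end

end MaxMatch

end

theorem mainTheorem5 {V : Type*} [Fintype V] [LinearOrder V]
    (G : SimpleGraph V) [DecidableRel G.Adj]
    (M : G.Subgraph) (hM : Maximal SimpleGraph.Subgraph.IsMatching M)
    (E : MaxMatch.Execution M) :
    E.matchedMoves.encard ≤
      ((12 * MaxMatch.numMatched M *
        (G.maxDegree * (MaxMatch.numSingle M + 6 * MaxMatch.numMatched M)
          + MaxMatch.numMatched M) : ℕ) : ℕ∞) := by
  -- The numerical comparison needs a matched node; without one there are no moves to count.
  by_cases hm : ∃ u, MaxMatch.Matched M u
  · obtain ⟨u, hu⟩ := hm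
    classical
    have hd : ∀ x, (Finset.univ.filter fun u => G.Adj x u).card ≤ G.maxDegree := fun x => by
      rw [← G.neighborFinset_eq_filter, G.card_neighborFinset_eq_degree]
      exact G.degree_le_maxDegree x
    have hd' : ∀ x, (@Finset.filter V (fun u => G.Adj x u)
        (fun _ => Classical.propDecidable _) Finset.univ).card ≤ G.maxDegree := fun x => by
      convert hd x
    refine E.encard_matchedMoves_le fun n => ?_
    have h1 := E.two_mul_card_movesBefore_le hd' hM.prop n
    have h2 := MaxMatch.movePotential_le (C := E.config 0) hd' hu
    omega
  · have : E.matchedMoves = ∅ :=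
      Set.eq_empty_of_forall_notMem fun q hq => hm ⟨q.2, hq.2.1⟩
    rw [this, Set.encard_empty]
    exact zero_le
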